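/- Let $\Bbbk$ be a field and let $S\subseteq\mathbb{N}_0$ be a numerical semigroup (a submonoid of $(\mathbb{N}_0,+)$ with finite complement) that is Arf, i.e. $b+c-a\in S$ whenever $a,b,c\in S$ and $a\le b\le c$. Let $m$ be its multiplicity (the least non-zero element of $S$), $F$ its Frobenius number (the greatest integer not in $S$, so $F=-1$ if $S=\mathbb{N}_0$) and $F+1$ its conductor. Let $n_1<\dots<n_e$ be the minimal generators of $S$, and let $I_S$ be the kernel of the $\Bbbk$-algebra homomorphism $\Bbbk[x_1,\dots,x_e]\to\Bbbk[S]=\Bbbk[t^s\mid s\in S]$, $x_i\mapsto t^{n_i}$. An RF-matrix of $F$ is a matrix $A=(a_{ij})\in\mathbb{Z}^{e\times e}$ with $a_{ii}=-1$ for all $i$, $a_{ij}\ge 0$ for $i\ne j$, and $\sum_{j=1}^e a_{ij}n_j=F$ for every $i$. For such an $A$ with rows $\mathbf{a}_1,\dots,\mathbf{a}_e$ put $W_A=\sum_{i<j}\mathbb{Z}(\mathbf{a}_i-\mathbf{a}_j)\subseteq\mathbb{Z}^e$. Suppose that $m\le 5$, or that the conductor $F+1$ is a multiple of $m$. Then there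 is an RF-matrix $A$ of $F$ such that, with $W(S)=W_A$, the ideal $I_S$ is generated by $$\{\mathbf{x}^{\mathbf{v}^+}-\mathbf{x}^{\mathbf{v}^-}\mid \mathbf{v}\in W(S)\},$$ where $\mathbf{v}^+$ and $\mathbf{v}^-$ are the vectors with components $\max(v_i,0)$ and $\max(-v_i,0)$. -/

import Mathlib

namespace ArfSemigroup

/-- A numerical semigroup: a submonoid of the non-negative integers with finite complement. -/
def IsNumericalSemigroup (S : AddSubmonoid ℕ) : Prop :=
  ((S : Set ℕ)ᶜ).Finite

/-- The Arf property. (The subtraction is exact because `a ≤ b`.) -/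
def IsArf (S : AddSubmonoid ℕ) : Prop :=
  ∀ a ∈ S, ∀ b ∈ S, ∀ c ∈ S, a ≤ b → b ≤ c → b + c - a ∈ S

/-- The multiplicity: the smallest non-zero element. -/
noncomputable def mult (S : AddSubmonoid ℕ) : ℕ :=
  sInf {s : ℕ | s ∈ S ∧ s ≠ 0}

/-- The Frobenius number: the greatest integer which is not in `S`. For a numerical semigroup
this is the greatest gap if there is one, and `-1` if `S` is all of `ℕ`. -/
noncomputable def frobeniusNumber (S : AddSubmonoid ℕ) : ℤ :=
  sSup {z : ℤ | ¬ ∃ s ∈ S, (s : ℤ) = z}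

/-- The conductor. -/
noncomputable def conductor (S : AddSubmonoid ℕ) : ℤ :=
  frobeniusNumber S + 1

/-- `n 0 < n 1 < ⋯` is the increasing enumeration of a minimal system of generators of `S`:
the `n i` generate `S` and no proper subset of them does. -/
structure IsMinimalGenerators (S : AddSubmonoid ℕ) {e : ℕ} (n : Fin e → ℕ) : Prop where
  strictMono : StrictMono n
  closure_eq : AddSubmonoid.closure (Set.range n) = S
  minimal : ∀ B : Set ℕ, B ⊂ Set.range n → AddSubmonoid.closure B ≠ S

theorem IsMinimalGenerators.mem {S : AddSubmonoid ℕ} {e : ℕ} {n : Fin e → ℕ}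
    (h : IsMinimalGenerators S n) (i : Fin e) : n i ∈ S :=
  h.closure_eq ▸ AddSubmonoid.subset_closure (Set.mem_range_self i)

/-- `A` is a row-factorization matrix of `f` with respect to the generators `n`. -/
structure IsRFMatrix {e : ℕ} (n : Fin e → ℕ) (f : ℤ) (A : Matrix (Fin e) (Fin e) ℤ) : Prop where
  diag : ∀ i, A i i = -1
  nonneg : ∀ i j, i ≠ j → 0 ≤ A i j
  row_sum : ∀ i, ∑ j, A i j * (n j : ℤ) = f

/-- The lattice in `ℤ ^ e` spanned by the differences of the rows of `A`. -/
def rowDiffLattice {e : ℕ} (A : Matrix (Fin e) (Fin e) ℤ) : Submodule ℤ (Fin e → ℤ) :=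
  Submodule.span ℤ {w | ∃ i j : Fin e, i < j ∧ w = A i - A j}

/-- The binomial `x ^ v⁺ - x ^ v⁻` attached to an integer vector `v`. Note that
`(v i).toNat = max (v i) 0` and `(-v i).toNat = max (-v i) 0`. -/
noncomputable def binomial (k : Type*) [Field k] {e : ℕ} (v : Fin e → ℤ) :
    MvPolynomial (Fin e) k :=
  ∏ i, MvPolynomial.X i ^ (v i).toNat - ∏ i, MvPolynomial.X i ^ (-v i).toNat

/-- The semigroup ring `k[S] = k[t ^ s | s ∈ S]` inside `k[t]`. -/
noncomputable def semigroupRing (k : Type*) [Field k] (S : AddSubmonoid ℕ) :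
    Subalgebra k (Polynomial k) :=
  Algebra.adjoin k {p | ∃ s ∈ S, p = Polynomial.X ^ s}

/-- The `k`-algebra map `k[x_1, …, x_e] → k[S]` sending `x_i` to `t ^ (n i)`. -/
noncomputable def semigroupRingMap (k : Type*) [Field k] {S : AddSubmonoid ℕ} {e : ℕ}
    {n : Fin e → ℕ} (hn : IsMinimalGenerators S n) :
    MvPolynomial (Fin e) k →ₐ[k] semigroupRing k S :=
  MvPolynomial.aeval fun i =>
    (⟨Polynomial.X ^ n i, Algebra.subset_adjoin ⟨n i, hn.mem i, rfl⟩⟩ : semigroupRing k S)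

/-- The defining ideal `I_S` of the semigroup ring `k[S]`. -/
noncomputable def definingIdeal (k : Type*) [Field k] {S : AddSubmonoid ℕ} {e : ℕ}
    {n : Fin e → ℕ} (hn : IsMinimalGenerators S n) : Ideal (MvPolynomial (Fin e) k) :=
  RingHom.ker (semigroupRingMap k hn)

end ArfSemigroup

namespace ArfSemigroup

/-! The ideal `I_S` is generated by the binomials of all integer relations among the generators, so
it suffices to find an RF-matrix whose row differences span the whole relation lattice.

The Arf property makes every nonzero Apéry element with respect to `m` a minimal generator. Hence
each integer is uniquely a multiple of `m` plus at most one other generator. This normal form `Φ`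
yields an RF-matrix with rows `Φ (F + n i) - e_i`. Modulo its row differences, shifting by `m` or by
`F` adds a fixed class to `Φ`. If `gcd(F, m) = 1`, so does shifting by 1, and the class of each
`e_j` is `n j` times one element, which kills every relation.

Coprimality holds if `m ∣ F + 1`, if `m` is 1 or prime (as `m ∤ F` for `m > 1`), and if `m = 4` with
`F` odd. For `m = 4`, `F ≡ 2 (mod 4)`, the Arf property determines the generators and one row is
chosen differently. -/

/-- The lattice of integer relations between the integers `n j`. -/
def relationLattice {e : ℕ} (n : Fin e → ℕ) : Submodule ℤ (Fin e → ℤ) where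
  carrier := {v | ∑ j, v j * (n j : ℤ) = 0}
  zero_mem' := by simp
  add_mem' := by
    intro a b ha hb
    simp only [Set.mem_ofPred_eq, Pi.add_apply, add_mul, Finset.sum_add_distrib] at *
    rw [ha, hb, add_zero]
  smul_mem' := by
    intro c a ha
    simp only [Set.mem_ofPred_eq, Pi.smul_apply, smul_eq_mul, mul_assoc, ← Finset.mul_sum] at *
    rw [ha, mul_zero]

theorem mem_relationLattice {e : ℕ} {n : Fin e → ℕ} {v : Fin e → ℤ} :
    v ∈ relationLattice n ↔ ∑ j, v j * (n j : ℤ) = 0 := Iff.rfl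

theorem IsRFMatrix.rowDiffLattice_le {e : ℕ} {n : Fin e → ℕ} {f : ℤ}
    {A : Matrix (Fin e) (Fin e) ℤ} (hA : IsRFMatrix n f A) :
    rowDiffLattice A ≤ relationLattice n := by
  refine Submodule.span_le.2 ?_
  rintro _ ⟨i, j, -, rfl⟩
  simp [mem_relationLattice, sub_mul, hA.row_sum]

theorem row_sub_row_mem_rowDiffLattice {e : ℕ} (A : Matrix (Fin e) (Fin e) ℤ) (i j : Fin e) :
    A i - A j ∈ rowDiffLattice A := by
  rcases lt_trichotomy i j with h | rfl | h
  · exact Submodule.subset_span ⟨i, j, h, rfl⟩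
  · simp
  · rw [← neg_sub]
    exact neg_mem (Submodule.subset_span ⟨j, i, h, rfl⟩)

/-- If the classes of the unit vectors modulo the row lattice are the multiples `n j • u` of one
element, the row lattice contains all relations. -/
theorem relationLattice_le_of_mkQ_single {e : ℕ} {n : Fin e → ℕ} (W : Submodule ℤ (Fin e → ℤ))
    (u : (Fin e → ℤ) ⧸ W) (hu : ∀ j, W.mkQ (Pi.single j 1) = (n j : ℤ) • u) :
    relationLattice n ≤ W := by
  intro v hv
  rw [← W.ker_mkQ, LinearMap.mem_ker]
  have : v = ∑ j, v j • (Pi.single j 1 : Fin e → ℤ) := by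
    ext i
    simp [Finset.sum_apply, Pi.single_apply]
  rw [this, map_sum]
  simp_rw [map_smul, hu, smul_smul]
  rw [← Finset.sum_smul, mem_relationLattice.1 hv, zero_smul]

/-! ### Binomials generating the defining ideal -/

theorem semigroupRingMap_monomial (k : Type*) [Field k] {S : AddSubmonoid ℕ} {e : ℕ}
    {n : Fin e → ℕ} (hn : IsMinimalGenerators S n) (u : Fin e → ℕ) :
    ((semigroupRingMap k hn (∏ i, MvPolynomial.X i ^ u i) : semigroupRing k S) : Polynomial k)
      = Polynomial.X ^ (∑ i, n i * u i) := by
  simp [semigroupRingMap, map_prod, map_pow, ← pow_mul, Finset.prod_pow_eq_pow_sum]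

theorem binomial_mem_definingIdeal (k : Type*) [Field k] {S : AddSubmonoid ℕ} {e : ℕ}
    {n : Fin e → ℕ} (hn : IsMinimalGenerators S n) {v : Fin e → ℤ}
    (hv : v ∈ relationLattice n) : binomial k v ∈ definingIdeal k hn := by
  rw [definingIdeal, RingHom.mem_ker, binomial, map_sub, sub_eq_zero]
  apply Subtype.ext
  refine (semigroupRingMap_monomial k hn _).trans
    (Eq.trans ?_ (semigroupRingMap_monomial k hn _).symm)
  congr 1
  have h := mem_relationLattice.1 hv
  zify
  rw [← sub_eq_zero, ← Finset.sum_sub_distrib, ← h]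
  refine Finset.sum_congr rfl fun i _ => ?_
  have : ((v i).toNat : ℤ) - ((-v i).toNat : ℤ) = v i := by omega
  linear_combination (n i : ℤ) * this

/-- Pulling out the common factor with exponents `min (u i) (w i)` leaves the binomial of `u - w`.
-/
theorem prod_X_pow_sub_mem_span (k : Type*) [Field k] {e : ℕ} (u w : Fin e → ℕ)
    (W : Submodule ℤ (Fin e → ℤ)) (h : (fun i => (u i : ℤ) - w i) ∈ W) :
    (∏ i, MvPolynomial.X i ^ u i - ∏ i, MvPolynomial.X i ^ w i : MvPolynomial (Fin e) k) ∈
      Ideal.span {p | ∃ v ∈ W, p = binomial k v} := by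
  have : (∏ i, MvPolynomial.X i ^ u i - ∏ i, MvPolynomial.X i ^ w i : MvPolynomial (Fin e) k) =
      (∏ i, MvPolynomial.X i ^ min (u i) (w i)) * binomial k (fun i => (u i : ℤ) - w i) := by
    simp only [binomial, mul_sub, ← Finset.prod_mul_distrib, ← pow_add]
    congr 1 <;> refine Finset.prod_congr rfl fun i _ => ?_ <;> congr 1 <;> omega
  rw [this]
  exact Ideal.mul_mem_left _ _ (Ideal.subset_span ⟨_, h, rfl⟩)

theorem definingIdeal_eq_span_binomial (k : Type*) [Field k] {S : AddSubmonoid ℕ} {e : ℕ}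
    {n : Fin e → ℕ} (hn : IsMinimalGenerators S n) :
    definingIdeal k hn =
      Ideal.span {p | ∃ v ∈ relationLattice n, p = binomial k v} := by
  apply le_antisymm
  · intro p hp
    set J := Ideal.span {p | ∃ v ∈ relationLattice n, p = binomial k v}
    let d : (Fin e → ℕ) → ℕ := fun u => ∑ i, n i * u i
    -- `Λ` sends `t ^ s` to one chosen monomial of degree `s`. Then `T` moves each monomial by an
    -- element of `J` and fixes the kernel pointwise.
    let Λ : Polynomial k →ₗ[k] MvPolynomial (Fin e) k :=
      (Polynomial.basisMonomials k).constr k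
        fun s => ∏ i, MvPolynomial.X i ^ (Function.invFun d s) i
    let T : MvPolynomial (Fin e) k →ₗ[k] MvPolynomial (Fin e) k :=
      LinearMap.id - Λ ∘ₗ (semigroupRing k S).val.toLinearMap ∘ₗ (semigroupRingMap k hn).toLinearMap
    have hT : ∀ q, T q ∈ J := by
      intro q
      induction q using MvPolynomial.induction_on' with
      | add p q hp hq => rw [map_add]; exact J.add_mem hp hq
      | monomial u c =>
        have hu : MvPolynomial.monomial u c =
            c • (∏ i, MvPolynomial.X i ^ u i : MvPolynomial (Fin e) k) := by
          rw [MvPolynomial.monomial_eq, MvPolynomial.smul_eq_C_mul, Finsupp.prod_fintype]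
          simp
        rw [hu, map_smul, MvPolynomial.smul_eq_C_mul]
        refine J.mul_mem_left _ ?_
        have hval : T (∏ i, MvPolynomial.X i ^ u i) = ∏ i, MvPolynomial.X i ^ u i -
            ∏ i, MvPolynomial.X i ^ (Function.invFun d (d u)) i := by
          simp only [T, LinearMap.sub_apply, LinearMap.id_apply, LinearMap.comp_apply,
            AlgHom.toLinearMap_apply, Subalgebra.coe_val]
          rw [semigroupRingMap_monomial]
          have := (Polynomial.basisMonomials k).constr_basis k
            (fun s => (∏ i, MvPolynomial.X i ^ (Function.invFun d s) i : MvPolynomial (Fin e) k))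
            (d u)
          simp only [Polynomial.coe_basisMonomials, Polynomial.monomial_one_right_eq_X_pow] at this
          rw [← this]
        rw [hval]
        refine prod_X_pow_sub_mem_span k _ _ _ ?_
        have h1 : d (Function.invFun d (d u)) = d u := Function.invFun_eq ⟨u, rfl⟩
        have h2 : (d (Function.invFun d (d u)) : ℤ) = d u := by rw [h1]
        simp only [d, Nat.cast_sum, Nat.cast_mul] at h2
        rw [mem_relationLattice]
        simp only [sub_mul, Finset.sum_sub_distrib]
        rw [sub_eq_zero]
        simp only [mul_comm _ (n _ : ℤ)]
        exact h2.symm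
    have hp' : semigroupRingMap k hn p = 0 := hp
    have := hT p
    simpa [T, hp'] using this
  · refine Ideal.span_le.2 ?_
    rintro _ ⟨v, hv, rfl⟩
    exact binomial_mem_definingIdeal k hn hv

/-! ### Generators of an Arf numerical semigroup -/

section Basic

variable {S : AddSubmonoid ℕ}

theorem exists_mem_gt (hS : IsNumericalSemigroup S) (N : ℕ) : ∃ s ∈ S, N < s := by
  by_contra! h
  refine (Set.Ioi_infinite N) (hS.subset fun x hx hxS => ?_)
  exact absurd (h x hxS) (not_le.2 hx)

theorem mult_mem_and_ne_zero (hS : IsNumericalSemigroup S) : mult S ∈ S ∧ mult S ≠ 0 := by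
  obtain ⟨s, hs, h0⟩ := exists_mem_gt hS 0
  exact Nat.sInf_mem (s := {s : ℕ | s ∈ S ∧ s ≠ 0}) ⟨s, hs, h0.ne'⟩

theorem mult_le {s : ℕ} (hs : s ∈ S) (h0 : s ≠ 0) : mult S ≤ s :=
  Nat.sInf_le ⟨hs, h0⟩

theorem isGreatest_frobeniusNumber (hS : IsNumericalSemigroup S) :
    IsGreatest {z : ℤ | ¬ ∃ s ∈ S, (s : ℤ) = z} (frobeniusNumber S) := by
  have hne : ({z : ℤ | ¬ ∃ s ∈ S, (s : ℤ) = z}).Nonempty :=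
    ⟨-1, by rintro ⟨s, -, h⟩; omega⟩
  have hbdd : BddAbove {z : ℤ | ¬ ∃ s ∈ S, (s : ℤ) = z} := by
    obtain ⟨B, hB⟩ := Set.Finite.bddAbove hS
    refine ⟨B, fun z hz => ?_⟩
    by_contra! h
    refine hz ⟨z.toNat, ?_, by omega⟩
    by_contra h'
    have := hB h'
    omega
  exact ⟨Int.csSup_mem hne hbdd, fun z hz => le_csSup hbdd hz⟩

theorem exists_eq_of_irreducible {e : ℕ} {n : Fin e → ℕ}
    (hn : AddSubmonoid.closure (Set.range n) = S) {s : ℕ} (hs : s ∈ S) (h0 : s ≠ 0)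
    (hirr : ∀ a ∈ S, ∀ b ∈ S, a ≠ 0 → b ≠ 0 → a + b ≠ s) : ∃ i, n i = s := by
  subst hn
  induction hs using AddSubmonoid.closure_induction with
  | mem x hx => exact hx
  | zero => exact absurd rfl h0
  | add x y hx hy ihx ihy =>
    by_cases hx0 : x = 0
    · subst hx0
      simp only [zero_add] at *
      exact ihy h0 hirr
    · by_cases hy0 : y = 0
      · subst hy0
        simp only [add_zero] at *
        exact ihx h0 hirr
      · exact absurd rfl (hirr x hx y hy hx0 hy0)

theorem IsMinimalGenerators.notMem_closure {e : ℕ} {n : Fin e → ℕ}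
    (hn : IsMinimalGenerators S n) (i : Fin e) :
    n i ∉ AddSubmonoid.closure (Set.range n \ {n i}) := by
  intro hi
  refine hn.minimal (Set.range n \ {n i}) ⟨Set.sdiff_subset, fun h => (h ⟨i, rfl⟩).2 rfl⟩ (le_antisymm ?_ ?_)
  · rw [← hn.closure_eq]
    exact AddSubmonoid.closure_mono Set.sdiff_subset
  · conv_lhs => rw [← hn.closure_eq]
    refine AddSubmonoid.closure_le.2 ?_
    rintro _ ⟨j, rfl⟩
    by_cases h : n j = n i
    · rw [h]; exact hi
    · exact AddSubmonoid.subset_closure ⟨⟨j, rfl⟩, h⟩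

theorem IsMinimalGenerators.ne_zero {e : ℕ} {n : Fin e → ℕ} (hn : IsMinimalGenerators S n)
    (i : Fin e) : n i ≠ 0 := by
  intro h
  have := hn.notMem_closure i
  rw [h] at this
  exact this (zero_mem _)

/-- Both summands would be smaller than `n i`, hence generated without `n i`, making `n i`
redundant. -/
theorem IsMinimalGenerators.add_ne {e : ℕ} {n : Fin e → ℕ} (hn : IsMinimalGenerators S n)
    (i : Fin e) {a b : ℕ} (ha : a ∈ S) (hb : b ∈ S) (ha0 : a ≠ 0) (hb0 : b ≠ 0) :
    a + b ≠ n i := by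
  intro hab
  refine hn.notMem_closure i ?_
  set B := Set.range n \ {n i}
  have hlt : ∀ s ∈ S, s < n i → s ∈ AddSubmonoid.closure B := by
    intro s hs
    rw [← hn.closure_eq] at hs
    induction hs using AddSubmonoid.closure_induction with
    | mem x hx => exact fun h => AddSubmonoid.subset_closure ⟨hx, h.ne⟩
    | zero => exact fun _ => zero_mem _
    | add x y _ _ ihx ihy =>
      exact fun h => add_mem (ihx (by omega)) (ihy (by omega))
  exact hab ▸ add_mem (hlt a ha (by omega)) (hlt b hb (by omega))

theorem IsArf.exists_mult_add (hArf : IsArf S) (hS : IsNumericalSemigroup S) {a b : ℕ}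
    (ha : a ∈ S) (hb : b ∈ S) (ha0 : a ≠ 0) (hb0 : b ≠ 0) :
    a + b - mult S ∈ S ∧ mult S < a + b := by
  have hm := mult_mem_and_ne_zero hS
  have h1 := mult_le ha ha0
  have h2 := mult_le hb hb0
  refine ⟨?_, by omega⟩
  rcases le_total a b with h | h
  · exact hArf _ hm.1 a ha b hb h1 h
  · rw [add_comm]
    exact hArf _ hm.1 b hb a ha h2 h

end Basic

/-! ### Apéry sets -/

/-- `T` is a monoid of non-negative integers with Frobenius number `F`, and `N` lists its
multiplicity `N o` together with the non-zero elements of its Apéry set. -/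
structure IsAperyFamily (T : AddSubmonoid ℤ) {e : ℕ} (N : Fin e → ℤ) (o : Fin e) (F : ℤ) :
    Prop where
  nonneg : ∀ z ∈ T, 0 ≤ z
  pos : 0 < N o
  mem : ∀ i, N i ∈ T
  ne_zero : ∀ i, N i ≠ 0
  injective : Function.Injective N
  sub_notMem : ∀ i, i ≠ o → N i - N o ∉ T
  cases : ∀ z ∈ T, z - N o ∈ T ∨ z = 0 ∨ ∃ i, i ≠ o ∧ z = N i
  notMem : F ∉ T
  mem_of_lt : ∀ z, F < z → z ∈ T

theorem isAperyFamily {S : AddSubmonoid ℕ} (hS : IsNumericalSemigroup S) (hArf : IsArf S)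
    {e : ℕ} {n : Fin e → ℕ} (hn : IsMinimalGenerators S n) :
    ∃ o, n o = mult S ∧ IsAperyFamily (S.map (Nat.castAddMonoidHom ℤ)) (fun i => (n i : ℤ)) o
      (frobeniusNumber S) := by
  have hm := mult_mem_and_ne_zero hS
  have hF := isGreatest_frobeniusNumber hS
  have hT : ∀ z : ℤ, z ∈ S.map (Nat.castAddMonoidHom ℤ) ↔ ∃ s ∈ S, (s : ℤ) = z := by
    intro z; simp [AddSubmonoid.mem_map]
  obtain ⟨o, ho⟩ := exists_eq_of_irreducible hn.closure_eq hm.1 hm.2 (by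
    intro a ha b hb ha0 hb0
    have := mult_le ha ha0
    have := mult_le hb hb0
    omega)
  refine ⟨o, ho, ?_, by omega, fun i => (hT _).2 ⟨_, hn.mem i, rfl⟩,
    fun i => by exact_mod_cast hn.ne_zero i,
    fun i j hij => hn.strictMono.injective (by exact_mod_cast hij), ?_, ?_, ?_, ?_⟩
  · intro z hz
    obtain ⟨s, -, rfl⟩ := (hT z).1 hz
    omega
  · intro i hi h
    obtain ⟨s, hs, h⟩ := (hT _).1 h
    refine hn.add_ne i hs (hn.mem o) ?_ (by omega) (by omega)
    rintro rfl
    exact hi (hn.strictMono.injective (by omega))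
  · intro z hz
    obtain ⟨s, hs, rfl⟩ := (hT z).1 hz
    by_cases h : (s : ℤ) - n o ∈ S.map (Nat.castAddMonoidHom ℤ)
    · exact Or.inl h
    by_cases h0 : s = 0
    · exact Or.inr (Or.inl (by exact_mod_cast h0))
    -- The Arf property enters here: a sum of two nonzero elements stays in `S` after subtracting
    -- `m`, so a nonzero Apéry element is irreducible.
    obtain ⟨i, rfl⟩ := exists_eq_of_irreducible hn.closure_eq hs h0 (by
      rintro a ha b hb ha0 hb0 rfl
      have := hArf.exists_mult_add hS ha hb ha0 hb0
      exact h ((hT _).2 ⟨_, this.1, by omega⟩))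
    refine Or.inr (Or.inr ⟨i, ?_, rfl⟩)
    rintro rfl
    exact h ((hT _).2 ⟨0, zero_mem _, by simp⟩)
  · rw [hT]; exact hF.1
  · intro z hz
    rw [hT]
    by_contra h
    exact absurd (hF.2 h) (not_le.2 hz)

namespace IsAperyFamily

variable {T : AddSubmonoid ℤ} {e : ℕ} {N : Fin e → ℤ} {o : Fin e} {F : ℤ}

theorem neg_one_le (h : IsAperyFamily T N o F) : -1 ≤ F := by
  by_contra! hF
  have := h.nonneg _ (h.mem_of_lt (-1) hF)
  omega

theorem mul_mem (h : IsAperyFamily T N o F) {q : ℤ} (hq : 0 ≤ q) : q * N o ∈ T := by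
  obtain ⟨k, rfl⟩ := Int.eq_ofNat_of_zero_le hq
  simpa using T.nsmul_mem (h.mem o) k

theorem exists_of_mem (h : IsAperyFamily T N o F) (z : ℤ) (hz : z ∈ T) :
    (∃ q : ℤ, 0 ≤ q ∧ z = q * N o) ∨ ∃ q : ℤ, ∃ i, 0 ≤ q ∧ i ≠ o ∧ z = q * N o + N i := by
  obtain ⟨k, hk⟩ := Int.eq_ofNat_of_zero_le (h.nonneg z hz)
  induction k using Nat.strong_induction_on generalizing z with
  | _ k ih =>
    rcases h.cases z hz with h1 | h1 | ⟨i, hi, h1⟩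
    · have := h.pos
      have := h.nonneg _ h1
      rcases ih (z - N o).toNat (by omega) _ h1 (by omega) with ⟨q, hq, h2⟩ | ⟨q, i, hq, hi, h2⟩
      · exact Or.inl ⟨q + 1, by omega, by linarith⟩
      · exact Or.inr ⟨q + 1, i, by omega, hi, by linarith⟩
    · exact Or.inl ⟨0, le_rfl, by simp [h1]⟩
    · exact Or.inr ⟨0, i, le_rfl, hi, by simp [h1]⟩

theorem exists_eq (h : IsAperyFamily T N o F) (z : ℤ) :
    (∃ q : ℤ, z = q * N o) ∨ ∃ q : ℤ, ∃ i, i ≠ o ∧ z = q * N o + N i := by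
  -- This shift by a multiple of `m` passes `F`, so membership is automatic.
  have hz : z + (|F| + |z| + 1) * N o ∈ T := by
    refine h.mem_of_lt _ ?_
    have h1 : |F| + |z| + 1 ≤ (|F| + |z| + 1) * N o :=
      le_mul_of_one_le_right (by positivity) h.pos
    have := le_abs_self F
    have := neg_abs_le z
    linarith
  rcases h.exists_of_mem _ hz with ⟨q, -, hq⟩ | ⟨q, i, -, hi, hq⟩
  · exact Or.inl ⟨q - (|F| + |z| + 1), by linarith⟩
  · exact Or.inr ⟨q - (|F| + |z| + 1), i, hi, by linarith⟩

theorem ne_add_mul (h : IsAperyFamily T N o F) {i : Fin e} (hi : i ≠ o) {t q : ℤ} (ht : t ∈ T)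
    (hq : 0 < q) : N i ≠ t + q * N o := by
  intro hh
  refine h.sub_notMem i hi ?_
  have : N i - N o = t + (q - 1) * N o := by linarith
  rw [this]
  exact add_mem ht (h.mul_mem (by omega))

theorem ne_mul (h : IsAperyFamily T N o F) {i : Fin e} (hi : i ≠ o) (q : ℤ) :
    N i ≠ q * N o := by
  intro hq
  rcases lt_or_ge 0 q with h0 | h0
  · exact h.ne_add_mul hi (zero_mem T) h0 (by simpa using hq)
  · have h1 := h.nonneg _ (h.mem i)
    have h2 := h.ne_zero i
    have h3 := mul_nonpos_of_nonpos_of_nonneg h0 h.pos.le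
    omega

theorem eq_of_sub_eq (h : IsAperyFamily T N o F) {i j : Fin e} (hi : i ≠ o) (hj : j ≠ o)
    {q : ℤ} (hq : N i - N j = q * N o) : i = j := by
  rcases lt_trichotomy q 0 with h0 | h0 | h0
  · exact absurd (by linarith) (h.ne_add_mul hj (h.mem i) (neg_pos.2 h0))
  · exact h.injective (by simpa [h0, sub_eq_zero] using hq)
  · exact absurd (by linarith) (h.ne_add_mul hi (h.mem j) h0)

end IsAperyFamily

/-! ### Normal forms and the coprime case -/

theorem apply_add_mul_of_apply_add {G : Type*} [AddCommGroup G] {φ : ℤ → G} {c : ℤ} {d : G}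
    (h : ∀ z, φ (z + c) = φ z + d) (x z : ℤ) : φ (z + x * c) = φ z + x • d := by
  induction x with
  | zero => simp
  | succ x ih => rw [add_mul, one_mul, ← add_assoc, h, ih, add_smul, one_smul, add_assoc]
  | pred x ih =>
    have h1 := h (z + (-(x : ℤ) - 1) * c)
    have h2 : z + (-(x : ℤ) - 1) * c + c = z + -(x : ℤ) * c := by ring
    rw [h2, ih] at h1
    rw [sub_smul, one_smul, ← add_sub_assoc, h1, add_sub_cancel_right]

/-- `Φ` assigns to each integer `z` its expression as a multiple of `N o` plus at most one
further `N i`. -/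
structure IsNormalForm {e : ℕ} (N : Fin e → ℤ) (o : Fin e) (Φ : ℤ → Fin e → ℤ) : Prop where
  mul : ∀ q : ℤ, Φ (q * N o) = q • Pi.single o 1
  mul_add : ∀ (q : ℤ) (i : Fin e), i ≠ o → Φ (q * N o + N i) = q • Pi.single o 1 + Pi.single i 1

namespace IsAperyFamily

variable {T : AddSubmonoid ℤ} {e : ℕ} {N : Fin e → ℤ} {o : Fin e} {F : ℤ}

theorem exists_isNormalForm (h : IsAperyFamily T N o F) : ∃ Φ, IsNormalForm N o Φ := by
  have key : ∀ z : ℤ, ∃ v : Fin e → ℤ, (∀ q : ℤ, z = q * N o → v = q • Pi.single o 1) ∧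
      ∀ (q : ℤ) (i : Fin e), i ≠ o → z = q * N o + N i →
        v = q • Pi.single o 1 + Pi.single i 1 := by
    intro z
    rcases h.exists_eq z with ⟨q, hq⟩ | ⟨q, i, hi, hq⟩
    · refine ⟨q • Pi.single o 1, fun q' hq' => ?_, fun q' j hj hq' => ?_⟩
      · rw [mul_right_cancel₀ h.pos.ne' (hq.symm.trans hq')]
      · exact absurd (by linarith) (h.ne_mul hj (q - q'))
    · refine ⟨q • Pi.single o 1 + Pi.single i 1, fun q' hq' => ?_, fun q' j hj hq' => ?_⟩
      · exact absurd (by linarith) (h.ne_mul hi (q' - q))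
      · obtain rfl := h.eq_of_sub_eq (q := q' - q) hi hj (by linarith)
        rw [mul_right_cancel₀ h.pos.ne' (show q * N o = q' * N o by linarith)]
  choose Φ h1 h2 using key
  exact ⟨Φ, fun q => h1 _ q rfl, fun q i hi => h2 _ q i hi rfl⟩

variable {Φ : ℤ → Fin e → ℤ}

theorem normalForm_zero (hΦ : IsNormalForm N o Φ) : Φ 0 = 0 := by
  simpa using hΦ.mul 0

theorem normalForm_apply (hΦ : IsNormalForm N o Φ) (i : Fin e) : Φ (N i) = Pi.single i 1 := by
  by_cases hi : i = o
  · subst hi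
    simpa using hΦ.mul 1
  · simpa using hΦ.mul_add 0 i hi

theorem normalForm_add_mul (h : IsAperyFamily T N o F) (hΦ : IsNormalForm N o Φ) (z q : ℤ) :
    Φ (z + q * N o) = Φ z + q • Pi.single o 1 := by
  rcases h.exists_eq z with ⟨r, rfl⟩ | ⟨r, i, hi, rfl⟩
  · rw [← add_mul, hΦ.mul, hΦ.mul, add_smul]
  · rw [add_right_comm, ← add_mul, hΦ.mul_add _ _ hi, hΦ.mul_add _ _ hi, add_smul,
      add_right_comm]

theorem sum_normalForm (h : IsAperyFamily T N o F) (hΦ : IsNormalForm N o Φ) (z : ℤ) :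
    ∑ j, Φ z j * N j = z := by
  rcases h.exists_eq z with ⟨r, rfl⟩ | ⟨r, i, hi, rfl⟩
  · simp [hΦ.mul, Pi.single_apply]
  · simp [hΦ.mul_add _ _ hi, Pi.single_apply, add_mul, Finset.sum_add_distrib]

theorem normalForm_nonneg (h : IsAperyFamily T N o F) (hΦ : IsNormalForm N o Φ) {z : ℤ}
    (hz : z ∈ T) (j : Fin e) : 0 ≤ Φ z j := by
  have hs : ∀ i : Fin e, 0 ≤ (Pi.single i 1 : Fin e → ℤ) j := fun i => by
    rw [Pi.single_apply]; split_ifs <;> simp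
  rcases h.exists_of_mem z hz with ⟨r, hr, rfl⟩ | ⟨r, i, hr, hi, rfl⟩
  · simpa [hΦ.mul] using mul_nonneg hr (hs o)
  · simpa [hΦ.mul_add _ _ hi] using add_nonneg (mul_nonneg hr (hs o)) (hs i)

theorem add_mem (h : IsAperyFamily T N o F) (i : Fin e) : F + N i ∈ T := by
  have := h.nonneg _ (h.mem i)
  have := h.ne_zero i
  exact h.mem_of_lt _ (by omega)

theorem ne_mul_frobenius (h : IsAperyFamily T N o F) {i : Fin e} (hi : i ≠ o) (q : ℤ) :
    F ≠ q * N o := by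
  intro hq
  have h1 := h.neg_one_le
  have h2 := h.pos
  rcases lt_or_ge q 0 with h0 | h0
  · have h3 : q * N o ≤ -1 * N o := mul_le_mul_of_nonneg_right (by omega) h2.le
    have h4 : N o = 1 := by omega
    exact h.ne_mul hi (N i) (by rw [h4, mul_one])
  · exact h.notMem (hq ▸ h.mul_mem h0)

/-- A positive coefficient of `m` in `F + m` would put `F` in `T`. For `i ≠ o`, a term `N i` in `F +
N i` would make `F` a multiple of `m`. -/
theorem normalForm_diag (h : IsAperyFamily T N o F) (hΦ : IsNormalForm N o Φ) (i : Fin e) :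
    Φ (F + N i) i = 0 := by
  by_cases hi : i = o
  · subst hi
    have hnn := h.normalForm_nonneg hΦ (h.add_mem i) i
    rcases h.exists_eq (F + N i) with ⟨r, hr⟩ | ⟨r, j, hj, hr⟩
    · rw [hr, hΦ.mul] at hnn ⊢
      simp only [Pi.smul_apply, Pi.single_eq_same, smul_eq_mul, mul_one] at hnn ⊢
      by_contra h0
      refine h.notMem ?_
      rw [show F = (r - 1) * N i by linarith]
      exact h.mul_mem (by omega)
    · rw [hr, hΦ.mul_add _ _ hj] at hnn ⊢
      simp only [Pi.add_apply, Pi.smul_apply, Pi.single_eq_same, smul_eq_mul, mul_one,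
        Pi.single_eq_of_ne hj.symm, add_zero] at hnn ⊢
      by_contra h0
      refine h.notMem ?_
      rw [show F = (r - 1) * N i + N j by linarith]
      exact T.add_mem (h.mul_mem (by omega)) (h.mem j)
  · rcases h.exists_eq (F + N i) with ⟨r, hr⟩ | ⟨r, j, hj, hr⟩
    · rw [hr, hΦ.mul]
      simp [hi]
    · have hij : i ≠ j := by
        rintro rfl
        exact h.ne_mul_frobenius hi r (by linarith)
      rw [hr, hΦ.mul_add _ _ hj]
      simp [hi, hij]

/-- The row-factorization row of `F` at `i` given by the normal form of `F + N i`. -/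
theorem normalForm_sub_single (h : IsAperyFamily T N o F) (hΦ : IsNormalForm N o Φ) (i : Fin e) :
    (Φ (F + N i) - Pi.single i 1 : Fin e → ℤ) i = -1 ∧
    (∀ j, i ≠ j → 0 ≤ (Φ (F + N i) - Pi.single i 1 : Fin e → ℤ) j) ∧
    ∑ j, (Φ (F + N i) - Pi.single i 1 : Fin e → ℤ) j * N j = F := by
  refine ⟨by simp [h.normalForm_diag hΦ i], fun j hj => ?_, ?_⟩
  · simpa [hj.symm] using h.normalForm_nonneg hΦ (h.add_mem i) j
  · simp [sub_mul, h.sum_normalForm hΦ, Pi.single_apply]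

theorem exists_isRFMatrix_of_isCoprime {n : Fin e → ℕ}
    (h : IsAperyFamily T (fun i => (n i : ℤ)) o F) (hcop : IsCoprime F (n o : ℤ)) :
    ∃ A, IsRFMatrix n F A ∧ rowDiffLattice A = relationLattice n := by
  obtain ⟨Φ, hΦ⟩ := h.exists_isNormalForm
  let A : Matrix (Fin e) (Fin e) ℤ := fun i => Φ (F + n i) - Pi.single i 1
  have hA : IsRFMatrix n F A :=
    ⟨fun i => (h.normalForm_sub_single hΦ i).1, fun i => (h.normalForm_sub_single hΦ i).2.1,
      fun i => (h.normalForm_sub_single hΦ i).2.2⟩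
  refine ⟨A, hA, le_antisymm hA.rowDiffLattice_le ?_⟩
  set W := rowDiffLattice A
  set f := W.mkQ (A o)
  set p := W.mkQ (Pi.single o 1)
  have hrow : ∀ i, W.mkQ (A i) = f := fun i => by
    rw [← sub_eq_zero, ← map_sub, ← LinearMap.mem_ker, W.ker_mkQ]
    exact row_sub_row_mem_rowDiffLattice A i o
  let φ : ℤ → (Fin e → ℤ) ⧸ W := fun z => W.mkQ (Φ z)
  have hp : ∀ q z, φ (z + q * n o) = φ z + q • p := fun q z => by
    simp only [φ, p]
    rw [h.normalForm_add_mul hΦ, map_add, map_smul]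
  have hφ : ∀ i, φ (n i) = W.mkQ (Pi.single i 1) := fun i => by
    simp only [φ]
    rw [normalForm_apply hΦ i]
  have hi : ∀ i, φ (F + n i) = f + φ (n i) := fun i => by
    rw [hφ, ← hrow i, ← map_add]
    simp [φ, A]
  have h0 : φ 0 = 0 := by simp only [φ, normalForm_zero hΦ, map_zero]
  have hF : φ F = f := by
    have h1 := hi o
    have h2 := hp 1 F
    rw [one_mul, one_smul, h1, hφ] at h2
    exact (add_right_cancel h2).symm
  -- Equality of all rows modulo `W` gives this at 0 and at each `n i`; translation by multiples of
  -- `m` extends it to all integers.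
  have hf : ∀ z, φ (z + F) = φ z + f := fun z => by
    rcases h.exists_eq z with ⟨q, rfl⟩ | ⟨q, i, -, rfl⟩
    · rw [add_comm, hp, hF, ← zero_add (q * (n o : ℤ)), hp, h0, zero_add, add_comm]
    · rw [show q * (n o : ℤ) + n i + F = F + n i + q * n o by ring, hp, hi,
        add_comm (q * (n o : ℤ)), hp]
      abel
  obtain ⟨x, y, hxy⟩ := hcop
  have hstep : ∀ z, φ (z + 1) = φ z + (x • f + y • p) := fun z => by
    rw [← hxy, ← add_assoc, hp, apply_add_mul_of_apply_add hf, add_assoc]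
  refine relationLattice_le_of_mkQ_single W (x • f + y • p) fun j => ?_
  have := apply_add_mul_of_apply_add hstep (n j) 0
  rwa [zero_add, mul_one, hφ, h0, zero_add] at this

end IsAperyFamily

/-! ### Multiplicity 4 with `F ≡ 2 (mod 4)` -/

theorem exists_smul_eq_of_relations {G : Type*} [AddCommGroup G] {p α β γ : G} {t : ℤ}
    (ra : (t + 1) • p + β - α = γ - p) (rb : t • p + α - β = γ - p)
    (rc : α + β - γ = γ - p) :
    ∃ u : G, p = (4 : ℤ) • u ∧ α = (4 * t + 5) • u ∧ β = (4 * t + 3) • u ∧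
      γ = (4 * t + 6) • u := by
  have hα : α = (2 * t + 2) • p - β := by
    linear_combination (norm := module) rc - ra - rb
  have hβ : (4 * t + 3) • p = (4 : ℤ) • β := by
    linear_combination (norm := module) rb - ra - (2 : ℤ) • hα
  have hγ : γ = (3 * t + 3) • p - (2 : ℤ) • β := by
    linear_combination (norm := module) hα - rb
  -- The generators are `4, 4t+5, 4t+3, 4t+6`, and `4(t+1) - (4t+3) = 1`.
  refine ⟨(t + 1) • p - β, ?_, ?_, ?_, ?_⟩
  · linear_combination (norm := module) -hβ
  · linear_combination (norm := module) hα - (t + 1) • hβ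
  · linear_combination (norm := module) -(t + 1) • hβ
  · linear_combination (norm := module) hγ - (t + 1) • hβ

theorem exists_isRFMatrix_of_mult_eq_four {S : AddSubmonoid ℕ} (hArf : IsArf S) {e : ℕ}
    {n : Fin e → ℕ} {o : Fin e} {F : ℤ}
    (h : IsAperyFamily (S.map (Nat.castAddMonoidHom ℤ)) (fun i => (n i : ℤ)) o F)
    (hm : n o = 4) (hF : F % 4 = 2) :
    ∃ A, IsRFMatrix n F A ∧ rowDiffLattice A = relationLattice n := by
  obtain ⟨Φ, hΦ⟩ := h.exists_isNormalForm
  have hm' : (n o : ℤ) = 4 := by exact_mod_cast hm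
  have hT : ∀ z : ℤ, z ∈ S.map (Nat.castAddMonoidHom ℤ) ↔ ∃ s ∈ S, (s : ℤ) = z := by
    intro z; simp [AddSubmonoid.mem_map]
  have hmem : ∀ i, n i ∈ S := fun i => by
    obtain ⟨s, hs, hi⟩ := (hT _).1 (h.mem i)
    rwa [← show s = n i by exact_mod_cast hi]
  have h4 : ∀ q : ℕ, 4 * q ∈ S := fun q => by
    have := S.nsmul_mem (hmem o) q
    rwa [hm, smul_eq_mul, mul_comm] at this
  have hF1 := h.neg_one_le
  -- Otherwise adding multiples of 4 to `s` would reach `F`.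
  have hlt : ∀ s ∈ S, s % 4 = 2 → F < s := fun s hs h2 => by
    by_contra! hle
    refine h.notMem ((hT _).2 ⟨_, S.add_mem hs (h4 ((F.toNat - s) / 4)), ?_⟩)
    omega
  have hle : ∀ i, i ≠ o → (n i : ℤ) ≤ F + 4 := fun i hi => by
    by_contra! hgt
    have := h.sub_notMem i hi
    simp only [hm'] at this
    exact this (h.mem_of_lt _ (by omega))
  have hres : ∀ r : ℤ, 0 < r → r < 4 → ∃ i, i ≠ o ∧ (n i : ℤ) % 4 = r := fun r h0 hr => by
    rcases h.exists_eq r with ⟨q, hq⟩ | ⟨q, i, hi, hq⟩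
    · simp only [hm'] at hq; omega
    · simp only [hm'] at hq; exact ⟨i, hi, by omega⟩
  have huniq : ∀ i j, i ≠ o → j ≠ o → (n i : ℤ) % 4 = (n j : ℤ) % 4 → i = j :=
    fun i j hi hj hij => h.eq_of_sub_eq (q := ((n i : ℤ) - n j) / 4) hi hj
      (by simp only [hm']; omega)
  obtain ⟨a, hao, ha⟩ := hres 1 (by norm_num) (by norm_num)
  obtain ⟨c, hco, hc⟩ := hres 2 (by norm_num) (by norm_num)
  obtain ⟨b, hbo, hb⟩ := hres 3 (by norm_num) (by norm_num)
  have hcv : (n c : ℤ) = F + 4 := by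
    have := hlt _ (hmem c) (by omega)
    have := hle c hco
    omega
  have hav : (n a : ℤ) = F + 3 := by
    -- Doubling `n a` and subtracting `n a - 1` gives `n a + 1 ≡ 2 (mod 4)` in `S`, so `n a + 1 >
    -- F`. For `b` the same device gives `n b + 3`.
    have h1 := hArf _ (h4 (n a / 4)) _ (hmem a) _ (hmem a) (by omega) le_rfl
    have := hlt _ h1 (by omega)
    have := hle a hao
    omega
  have hbv : (n b : ℤ) = F + 1 := by
    have h1 := hArf _ (h4 (n b / 4)) _ (hmem b) _ (hmem b) (by omega) le_rfl
    have := hlt _ h1 (by omega)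
    have := hle b hbo
    omega
  have hac : a ≠ c := by rintro rfl; omega
  have hbc : b ≠ c := by rintro rfl; omega
  have hex : ∀ i, i = o ∨ i = a ∨ i = b ∨ i = c := fun i => by
    by_cases hi : i = o
    · exact Or.inl hi
    have h0 : (n i : ℤ) % 4 ≠ 0 := fun h0 => h.ne_mul hi (n i / 4) (by simp only [hm']; omega)
    have : (n i : ℤ) % 4 = 1 ∨ (n i : ℤ) % 4 = 3 ∨ (n i : ℤ) % 4 = 2 := by omega
    rcases this with h1 | h1 | h1
    · exact Or.inr (Or.inl (huniq _ _ hi hao (by omega)))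
    · exact Or.inr (Or.inr (Or.inl (huniq _ _ hi hbo (by omega))))
    · exact Or.inr (Or.inr (Or.inr (huniq _ _ hi hco (by omega))))
  obtain ⟨t, rfl⟩ : ∃ t : ℤ, F = 4 * t + 2 := ⟨F / 4, by omega⟩
  let E : Fin e → Fin e → ℤ := fun i => Pi.single i 1
  -- The normal form of `F + n c` is a multiple of `e_o`; that row would make the row differences
  -- dependent, of rank 2 instead of 3. The replacement uses `n a + n b = F + n c`.
  let A : Matrix (Fin e) (Fin e) ℤ := fun i =>
    if i = c then E a + E b - E c else Φ (4 * t + 2 + n i) - E i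
  have hAc : A c = E a + E b - E c := if_pos rfl
  have hAi : ∀ i, i ≠ c → A i = Φ (4 * t + 2 + n i) - E i := fun i hi => if_neg hi
  have hAo : A o = E c - E o := by
    rw [hAi o hco.symm, hm', show 4 * t + 2 + 4 = (n c : ℤ) by omega,
      IsAperyFamily.normalForm_apply hΦ c]
  have hAa : A a = (t + 1) • E o + E b - E a := by
    rw [hAi a hac, show 4 * t + 2 + (n a : ℤ) = (t + 1) * n o + n b by rw [hm']; omega,
      hΦ.mul_add _ b hbo]
  have hAb : A b = t • E o + E a - E b := by
    rw [hAi b hbc, show 4 * t + 2 + (n b : ℤ) = t * n o + n a by rw [hm']; omega, hΦ.mul_add _ a hao]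
  have hA : IsRFMatrix n (4 * t + 2) A := by
    constructor
    · intro i
      by_cases hi : i = c
      · subst hi
        simp [hAc, E, hac.symm, hbc.symm]
      · rw [hAi i hi]
        exact (h.normalForm_sub_single hΦ i).1
    · intro i j hij
      by_cases hi : i = c
      · subst hi
        simp only [hAc, E, Pi.add_apply, Pi.sub_apply, Pi.single_apply, hij.symm, if_false]
        split_ifs <;> simp
      · rw [hAi i hi]
        exact (h.normalForm_sub_single hΦ i).2.1 j hij
    · intro i
      by_cases hi : i = c
      · subst hi
        simp [hAc, E, sub_mul, add_mul, Finset.sum_add_distrib, Pi.single_apply]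
        omega
      · rw [hAi i hi]
        exact (h.normalForm_sub_single hΦ i).2.2
  refine ⟨A, hA, le_antisymm hA.rowDiffLattice_le ?_⟩
  set W := rowDiffLattice A
  have hrow : ∀ i, W.mkQ (A i) = W.mkQ (A o) := fun i => by
    rw [← sub_eq_zero, ← map_sub, ← LinearMap.mem_ker, W.ker_mkQ]
    exact row_sub_row_mem_rowDiffLattice A i o
  have ra := hrow a
  have rb := hrow b
  have rc := hrow c
  rw [hAo] at ra rb rc
  rw [hAa] at ra
  rw [hAb] at rb
  rw [hAc] at rc
  simp only [map_add, map_sub, map_smul] at ra rb rc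
  set p := W.mkQ (E o)
  set α := W.mkQ (E a)
  set β := W.mkQ (E b)
  set γ := W.mkQ (E c)
  obtain ⟨u, hp, hα, hβ, hγ⟩ := exists_smul_eq_of_relations ra rb rc
  refine relationLattice_le_of_mkQ_single W u fun j => ?_
  rcases hex j with rfl | rfl | rfl | rfl
  · rw [hm']; exact hp
  · rw [hav]; exact hα.trans (by ring_nf)
  · rw [hbv]; exact hβ.trans (by ring_nf)
  · rw [hcv]; exact hγ.trans (by ring_nf)

/-! ### Assembling the cases -/

theorem isCoprime_frobenius {T : AddSubmonoid ℤ} {e : ℕ} {N : Fin e → ℤ} {o : Fin e} {F : ℤ}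
    (h : IsAperyFamily T N o F) (hp : N o = 1 ∨ Prime (N o)) : IsCoprime F (N o) := by
  rcases hp with hp | hp
  · rw [hp]; exact isCoprime_one_right
  · refine ((Prime.coprime_iff_not_dvd hp).2 ?_).symm
    rintro ⟨q, hq⟩
    have h1 := h.neg_one_le
    have h2 := h.pos
    have hq0 : 0 ≤ q := by
      by_contra! h0
      have h3 : q * N o ≤ -1 * N o := mul_le_mul_of_nonneg_right (by omega) h2.le
      have h4 : N o = 1 := by linarith
      exact hp.not_isUnit (by rw [h4]; exact isUnit_one)
    exact h.notMem (by rw [hq, mul_comm]; exact h.mul_mem hq0)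

theorem exists_isRFMatrix {S : AddSubmonoid ℕ} (hS : IsNumericalSemigroup S) (hArf : IsArf S)
    (hmc : mult S ≤ 5 ∨ (mult S : ℤ) ∣ conductor S) {e : ℕ} {n : Fin e → ℕ}
    (hn : IsMinimalGenerators S n) :
    ∃ A, IsRFMatrix n (frobeniusNumber S) A ∧ rowDiffLattice A = relationLattice n := by
  obtain ⟨o, ho, h⟩ := isAperyFamily hS hArf hn
  rw [← ho] at hmc
  rcases hmc with hm | ⟨q, hq⟩
  · have hpos : 0 < n o := by exact_mod_cast h.pos
    have hcases : n o = 4 ∨ (n o = 1 ∨ (n o).Prime) := by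
      interval_cases n o <;> norm_num
    rcases hcases with h4 | h1
    · have h5 : frobeniusNumber S % 4 ≠ 0 := fun h0 => by
        have := h.neg_one_le
        refine h.notMem ?_
        rw [show frobeniusNumber S = frobeniusNumber S / 4 * n o by rw [h4]; push_cast; omega]
        exact h.mul_mem (by omega)
      have h6 : frobeniusNumber S % 4 = 2 ∨ frobeniusNumber S % 4 = 1 ∨
        frobeniusNumber S % 4 = 3 := by omega
      rcases h6 with h6 | h6 | h6
      · exact exists_isRFMatrix_of_mult_eq_four hArf h h4 h6
      · exact h.exists_isRFMatrix_of_isCoprime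
          ⟨1, -(frobeniusNumber S / 4), by rw [h4]; push_cast; omega⟩
      · exact h.exists_isRFMatrix_of_isCoprime
          ⟨-1, frobeniusNumber S / 4 + 1, by rw [h4]; push_cast; omega⟩
    · refine h.exists_isRFMatrix_of_isCoprime (isCoprime_frobenius h ?_)
      exact h1.imp (fun h1 => by exact_mod_cast h1) Nat.prime_iff_prime_int.1
  -- Here `F + 1 = q m` is itself the Bézout identity.
  · refine h.exists_isRFMatrix_of_isCoprime ⟨-1, q, ?_⟩
    rw [conductor] at hq
    linarith

end ArfSemigroup

theorem mainTheorem3 (k : Type*) [Field k] (S : AddSubmonoid ℕ)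
    (hS : ArfSemigroup.IsNumericalSemigroup S) (hArf : ArfSemigroup.IsArf S)
    (hmc : ArfSemigroup.mult S ≤ 5 ∨ (ArfSemigroup.mult S : ℤ) ∣ ArfSemigroup.conductor S)
    {e : ℕ} (n : Fin e → ℕ) (hn : ArfSemigroup.IsMinimalGenerators S n) :
    ∃ A : Matrix (Fin e) (Fin e) ℤ,
      ArfSemigroup.IsRFMatrix n (ArfSemigroup.frobeniusNumber S) A ∧
      ArfSemigroup.definingIdeal k hn =
        Ideal.span {p | ∃ v ∈ ArfSemigroup.rowDiffLattice A,
          p = ArfSemigroup.binomial k v} := by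
  obtain ⟨A, hA, hW⟩ := ArfSemigroup.exists_isRFMatrix hS hArf hmc hn
  exact ⟨A, hA, hW ▸ ArfSemigroup.definingIdeal_eq_span_binomial k hn⟩
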